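/- Let $0<a<\infty$ and $I=(-a,a)$. Let $\mathcal D'(I)$ be the space of complex distributions on $I$, i.e. of continuous linear functionals $u:C_c^\infty(I)\to\mathbb C$ on the complex-valued test functions; put $\langle u',\varphi\rangle=-\langle u,\varphi'\rangle$ and, for a complex-valued $q\in C^\infty(I)$, $\langle qu,\varphi\rangle=\langle u,q\varphi\rangle$. Let $q\in C^\infty(I)$. Then every $u\in\mathcal D'(I)$ with $u''=qu$ in $\mathcal D'(I)$ is a classical solution: there is a function $f\in C^\infty(I)$ with $f''(x)=q(x)f(x)$ for all $x\in I$ and $\langle u,\varphi\rangle=\int_I f(x)\varphi(x)\,dx$ for all $\varphi\in C_c^\infty(I)$. -/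

import Mathlib

open TopologicalSpace MeasureTheory
open scoped Distributions ContDiff

/-- The open interval `(-a, a)`. -/
def symmInterval (a : ℝ) : Opens ℝ := ⟨Set.Ioo (-a) a, isOpen_Ioo⟩

/-- Complex distributions on the open set `Ω ⊆ ℝ`: continuous `ℂ`-linear functionals on the space
`C_c^∞(Ω)` of complex-valued test functions, which carries its inductive limit topology. (The space
`𝓓'(Ω, ℂ)` of Mathlib pairs with real-valued test functions only, so that `⟨u, q φ⟩` would make no
sense in it for a complex-valued `q`.) -/
abbrev CDistribution (Ω : Opens ℝ) : Type := 𝓓(Ω, ℂ) →L[ℂ] ℂ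

namespace CDistribution

variable {Ω : Opens ℝ}

/-- The derivative `φ ↦ φ'` on `C_c^∞(Ω)`. -/
noncomputable def testDeriv : 𝓓(Ω, ℂ) →L[ℂ] 𝓓(Ω, ℂ) :=
  TestFunction.lineDerivCLM ℂ (1 : ℝ)

theorem testDeriv_apply (φ : 𝓓(Ω, ℂ)) (x : ℝ) : testDeriv φ x = deriv φ x := by
  rw [testDeriv, TestFunction.lineDerivCLM_apply_of_le (by simp)]
  simp [lineDeriv, deriv_comp_const_add]

/-- The distributional derivative: `⟨u', φ⟩ = -⟨u, φ'⟩`. -/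
noncomputable def derivative (u : CDistribution Ω) : CDistribution Ω :=
  -(u.comp testDeriv)

theorem derivative_apply (u : CDistribution Ω) (φ : 𝓓(Ω, ℂ)) :
    u.derivative φ = -u (testDeriv φ) := rfl

/-- The product `q φ` of a function `q` that is smooth on `Ω` and a test function `φ` on `Ω`. Values
of `q` outside `Ω` play no role, since `φ` vanishes there. -/
noncomputable def testMul (q : ℝ → ℂ) (hq : ContDiffOn ℝ ∞ q Ω) (φ : 𝓓(Ω, ℂ)) : 𝓓(Ω, ℂ) where
  toFun x := q x * φ x
  contDiff' := by
    rw [contDiff_iff_contDiffAt]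
    intro x
    by_cases hx : x ∈ tsupport φ
    · exact (hq.contDiffAt (Ω.isOpen.mem_nhds (φ.tsupport_subset hx))).mul φ.contDiff.contDiffAt
    · refine (contDiffAt_const (c := (0 : ℂ))).congr_of_eventuallyEq ?_
      filter_upwards [notMem_tsupport_iff_eventuallyEq.mp hx] with y hy
      simp [hy]
  hasCompactSupport' := φ.hasCompactSupport.mul_left
  tsupport_subset' := (tsupport_mul_subset_right (f := q) (g := φ)).trans φ.tsupport_subset

theorem continuous_testMul_comp (q : ℝ → ℂ) (hq : ContDiffOn ℝ ∞ q Ω) (K : Compacts ℝ)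
    (hK : (K : Set ℝ) ⊆ Ω) :
    Continuous (testMul q hq ∘ TestFunction.ofSupportedIn (F := ℂ) (n := ⊤) hK) := by
  obtain ⟨χ, h0, h1, -⟩ := exists_contMDiffMap_zero_one_nhds_of_isClosed (n := ⊤)
    (modelWithCornersSelf ℝ ℝ) Ω.isOpen.isClosed_compl K.isCompact.isClosed
    (Set.disjoint_compl_left_iff_subset.mpr hK)
  have hχ : ContDiff ℝ ∞ χ := χ.contMDiff.contDiff
  have hg : ContDiff ℝ ∞ (fun x ↦ (χ x : ℂ) * q x) := by
    rw [contDiff_iff_contDiffAt]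
    intro x
    by_cases hx : x ∈ Ω
    · exact (Complex.ofRealCLM.contDiff.comp hχ).contDiffAt.mul
        (hq.contDiffAt (Ω.isOpen.mem_nhds hx))
    · refine (contDiffAt_const (c := (0 : ℂ))).congr_of_eventuallyEq ?_
      filter_upwards [h0.filter_mono (nhds_le_nhdsSet (Set.mem_compl hx))] with y hy
      simp [hy]
  have key : testMul q hq ∘ TestFunction.ofSupportedIn (F := ℂ) (n := ⊤) hK =
      TestFunction.ofSupportedIn hK ∘
        ContDiffMapSupportedIn.bilinLeftCLM (ContinuousLinearMap.mul ℂ ℂ) hg := by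
    ext φ x
    change q x * φ x = φ x * ((χ x : ℂ) * q x)
    by_cases hx : x ∈ K
    · rw [h1.self_of_nhdsSet x hx]
      push_cast
      ring
    · rw [φ.zero_on_compl hx]
      simp
  rw [key]
  exact (TestFunction.continuous_ofSupportedIn hK).comp (ContinuousLinearMap.continuous _)

/-- Multiplication by a function that is smooth on `Ω`, as a continuous operator on
`C_c^∞(Ω)`. -/
noncomputable def testMulCLM (q : ℝ → ℂ) (hq : ContDiffOn ℝ ∞ q Ω) : 𝓓(Ω, ℂ) →L[ℂ] 𝓓(Ω, ℂ) :=
  TestFunction.mkCLM ℂ (testMul q hq)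
    (fun f g ↦ TestFunction.ext fun x ↦ mul_add (q x) (f x) (g x))
    (fun c f ↦ TestFunction.ext fun x ↦ mul_left_comm (q x) c (f x))
    (continuous_testMul_comp q hq)

/-- The product `q u` of a function that is smooth on `Ω` and a distribution on `Ω`:
`⟨q u, φ⟩ = ⟨u, q φ⟩`. -/
noncomputable def smoothMul (q : ℝ → ℂ) (hq : ContDiffOn ℝ ∞ q Ω) (u : CDistribution Ω) :
    CDistribution Ω :=
  u.comp (testMulCLM q hq)

theorem smoothMul_apply (q : ℝ → ℂ) (hq : ContDiffOn ℝ ∞ q Ω) (u : CDistribution Ω)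
    (φ : 𝓓(Ω, ℂ)) : smoothMul q hq u φ = u (testMul q hq φ) := rfl

/-- `u` is the regular distribution given by the locally integrable function `f` on `Ω`. -/
def IsRegularOf (u : CDistribution Ω) (f : ℝ → ℂ) : Prop :=
  LocallyIntegrableOn f Ω volume ∧ ∀ φ : 𝓓(Ω, ℂ), u φ = ∫ x in Ω, f x * φ x

end CDistribution

/-! The equation says that `u` annihilates every test function `φ'' - q φ`. Let `y₁`, `y₂` be smooth
solutions with Wronskian 1. If `∫ y₁ ψ = ∫ y₂ ψ = 0`, the primitives `P₁`, `P₂` of `y₁ ψ`, `y₂ ψ`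
are again test functions, and `φ = y₂ P₁ - y₁ P₂` satisfies `φ'' - q φ = ψ`
(`exists_testDeriv_testDeriv_sub_testMul`). So `u` vanishes on the common kernel of two functionals
and is a linear combination of them: `u` is given by `c y₁ + d y₂`. The solutions come from a Picard
series that converges on the whole interval (`exists_hasDerivAt_linear`). -/

/-! ### Linear differential equations: global existence and smoothness -/

section LinearODE

variable {E : Type*} [NormedAddCommGroup E] [NormedSpace ℝ E]

/-- The terms of the Picard series for the linear equation `y' = A y` with `y 0 = v`. -/
noncomputable def picardTerm (A : ℝ → E →L[ℝ] E) (v : E) : ℕ → ℝ → E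
  | 0, _ => v
  | n + 1, x => ∫ t in (0 : ℝ)..x, A t (picardTerm A v n t)

variable {a : ℝ} {A : ℝ → E →L[ℝ] E}

/-- Each integration raises the power of `|x|` and supplies the next factor of the factorial, so the
Picard series is dominated by an exponential series. -/
theorem norm_picardTerm_le (v : E) {r M : ℝ} (hM : ∀ x ∈ Set.Ioo (-r) r, ‖A x‖ ≤ M) (n : ℕ)
    {x : ℝ} (hx : x ∈ Set.Ioo (-r) r) :
    ‖picardTerm A v n x‖ ≤ ‖v‖ * (M * |x|) ^ n / n.factorial := by
  have h0 : (0 : ℝ) ∈ Set.Ioo (-r) r := by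
    constructor <;> linarith [hx.1, hx.2]
  have hM0 : 0 ≤ M := (norm_nonneg _).trans (hM 0 h0)
  induction n generalizing x with
  | zero => simp [picardTerm]
  | succ n ih =>
    have hc : Continuous fun t : ℝ ↦ M * (‖v‖ * (M * |t - 0|) ^ n / n.factorial) := by fun_prop
    calc ‖picardTerm A v (n + 1) x‖
        ≤ |∫ t in (0 : ℝ)..x, M * (‖v‖ * (M * |t - 0|) ^ n / n.factorial)| := by
          refine intervalIntegral.norm_integral_le_abs_of_norm_le ?_ (hc.intervalIntegrable _ _)
          refine (ae_restrict_mem measurableSet_uIoc).mono fun t ht ↦ ?_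
          have ht' := Set.ordConnected_Ioo.uIcc_subset h0 hx (Set.uIoc_subset_uIcc ht)
          rw [sub_zero]
          exact (ContinuousLinearMap.le_opNorm _ _).trans
            (mul_le_mul (hM t ht') (ih ht') (norm_nonneg _) hM0)
      _ = ‖v‖ * (M * |x|) ^ (n + 1) / (n + 1).factorial := by
          have : (fun t : ℝ ↦ M * (‖v‖ * (M * |t - 0|) ^ n / n.factorial)) =
              fun t ↦ M * (‖v‖ * M ^ n / n.factorial) * |t - 0| ^ n := by
            ext t; ring
          rw [this, intervalIntegral.abs_intervalIntegral_eq, integral_const_mul,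
            integral_pow_abs_sub_uIoc, sub_zero, abs_of_nonneg (by positivity),
            Nat.factorial_succ]
          push_cast
          field_simp
          ring

variable [CompleteSpace E]

theorem hasDerivAt_integral_of_continuousOn_Ioo {g : ℝ → E}
    (hg : ContinuousOn g (Set.Ioo (-a) a)) {x : ℝ} (hx : x ∈ Set.Ioo (-a) a) :
    HasDerivAt (fun z ↦ ∫ t in (0 : ℝ)..z, g t) (g x) x := by
  have h0 : (0 : ℝ) ∈ Set.Ioo (-a) a := by
    constructor <;> linarith [hx.1, hx.2]
  refine intervalIntegral.integral_hasDerivAt_right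
    (hg.mono (Set.ordConnected_Ioo.uIcc_subset h0 hx)).intervalIntegrable
    (hg.stronglyMeasurableAtFilter isOpen_Ioo x hx) (hg.continuousAt (isOpen_Ioo.mem_nhds hx))

theorem continuousOn_picardTerm (hA : ContinuousOn A (Set.Ioo (-a) a)) (v : E) (n : ℕ) :
    ContinuousOn (picardTerm A v n) (Set.Ioo (-a) a) := by
  induction n with
  | zero => exact continuousOn_const
  | succ n ih =>
    exact fun x hx ↦
      (hasDerivAt_integral_of_continuousOn_Ioo (hA.clm_apply ih) hx).continuousAt.continuousWithinAt

theorem hasDerivAt_picardTerm_succ (hA : ContinuousOn A (Set.Ioo (-a) a)) (v : E) (n : ℕ)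
    {x : ℝ} (hx : x ∈ Set.Ioo (-a) a) :
    HasDerivAt (picardTerm A v (n + 1)) (A x (picardTerm A v n x)) x :=
  hasDerivAt_integral_of_continuousOn_Ioo (hA.clm_apply (continuousOn_picardTerm hA v n)) hx

/-- A linear equation `y' = A y` with continuous coefficients has a solution on the whole
interval. -/
theorem exists_hasDerivAt_linear (hA : ContinuousOn A (Set.Ioo (-a) a)) (v : E) :
    ∃ y : ℝ → E, y 0 = v ∧ ∀ x ∈ Set.Ioo (-a) a, HasDerivAt y (A x (y x)) x := by
  refine ⟨fun x ↦ ∑' n, picardTerm A v n x, ?_, fun x hx ↦ ?_⟩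
  · beta_reduce
    rw [tsum_eq_single 0]
    · rfl
    · intro n hn
      obtain ⟨m, rfl⟩ := Nat.exists_eq_succ_of_ne_zero hn
      simp [picardTerm]
  -- `A` may be unbounded near `±a`; uniform bounds are available only on a smaller interval around
  -- `x`.
  obtain ⟨r, hxr, hra⟩ := exists_between (abs_lt.mpr hx)
  have hr0 : 0 ≤ r := (abs_nonneg x).trans hxr.le
  have hsub : Set.Icc (-r) r ⊆ Set.Ioo (-a) a := Set.Icc_subset_Ioo (by linarith) hra
  obtain ⟨M, hM⟩ := isCompact_Icc.exists_bound_of_continuousOn (hA.mono hsub)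
  have hM' : ∀ x ∈ Set.Ioo (-r) r, ‖A x‖ ≤ M := fun x hx ↦ hM x (Set.Ioo_subset_Icc_self hx)
  have hM0 : 0 ≤ M := (norm_nonneg _).trans (hM 0 ⟨by linarith, hr0⟩)
  have hb : ∀ n, ∀ y ∈ Set.Ioo (-r) r,
      ‖picardTerm A v n y‖ ≤ ‖v‖ * ((M * r) ^ n / n.factorial) := fun n y hy ↦ by
    refine (norm_picardTerm_le v hM' n hy).trans ?_
    rw [mul_div_assoc]
    have := (abs_lt.mpr hy).le
    gcongr
  have hsum : Summable fun n : ℕ ↦ ‖v‖ * ((M * r) ^ n / n.factorial) :=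
    (Real.summable_pow_div_factorial _).mul_left _
  have hs : ∀ y ∈ Set.Ioo (-r) r, Summable fun n ↦ picardTerm A v n y := fun y hy ↦
    .of_norm_bounded hsum fun n ↦ hb n y hy
  have hx' : x ∈ Set.Ioo (-r) r := abs_lt.mp hxr
  -- The termwise derivatives: the constant term contributes 0, and the rest is `A` applied to the
  -- series shifted by one.
  let g' : ℕ → ℝ → E := fun n y ↦ Nat.casesOn n 0 fun m ↦ A y (picardTerm A v m y)
  let u : ℕ → ℝ := fun n ↦ Nat.casesOn n 0 fun m ↦ M * (‖v‖ * ((M * r) ^ m / m.factorial))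
  have hu : Summable u := (summable_nat_add_iff 1).mp (hsum.mul_left M)
  have hg' : ∀ n y, y ∈ Set.Ioo (-r) r → ‖g' n y‖ ≤ u n := by
    rintro (_ | n) y hy
    · simp [g', u]
    · exact (ContinuousLinearMap.le_opNorm _ _).trans
        (mul_le_mul (hM' y hy) (hb n y hy) (norm_nonneg _) hM0)
  have key := hasDerivAt_tsum_of_isPreconnected (g := picardTerm A v) (g' := g') hu isOpen_Ioo
    isPreconnected_Ioo (by
      rintro (_ | n) y hy
      · exact hasDerivAt_const y v
      · exact hasDerivAt_picardTerm_succ hA v n (hsub (Set.Ioo_subset_Icc_self hy)))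
    hg' hx' (hs x hx') hx'
  convert key using 1
  rw [(Summable.of_norm_bounded hu fun n ↦ hg' n x hx').tsum_eq_zero_add, (A x).map_tsum (hs x hx')]
  simp [g']

end LinearODE

/-- The equation `y'' = q y` with smooth `q` has a smooth solution with prescribed initial data on
the whole interval. -/
theorem exists_smooth_solution {a : ℝ} {q : ℝ → ℂ} (hq : ContDiffOn ℝ ∞ q (Set.Ioo (-a) a))
    (v w : ℂ) : ∃ y z : ℝ → ℂ, y 0 = v ∧ z 0 = w ∧ ContDiffOn ℝ ∞ y (Set.Ioo (-a) a) ∧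
      ContDiffOn ℝ ∞ z (Set.Ioo (-a) a) ∧ (∀ x ∈ Set.Ioo (-a) a, HasDerivAt y (z x) x) ∧
      ∀ x ∈ Set.Ioo (-a) a, HasDerivAt z (q x * y x) x := by
  -- The first-order system `(y, z)' = (z, q y)`.
  let A : ℝ → ℂ × ℂ →L[ℝ] ℂ × ℂ := fun x ↦
    (ContinuousLinearMap.inl ℝ ℂ ℂ).comp (.snd ℝ ℂ ℂ) +
      (ContinuousLinearMap.inr ℝ ℂ ℂ).comp
        ((ContinuousLinearMap.mul ℝ ℂ (q x)).comp (.fst ℝ ℂ ℂ))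
  have hA : ContinuousOn A (Set.Ioo (-a) a) := by
    have := hq.continuousOn
    fun_prop
  obtain ⟨Y, hY0, hY⟩ := exists_hasDerivAt_linear hA (v, w)
  have h1 : ∀ x ∈ Set.Ioo (-a) a, HasDerivAt (fun t ↦ (Y t).1) (Y x).2 x := fun x hx ↦ by
    simpa [A, Function.comp_def] using
      ((ContinuousLinearMap.fst ℝ ℂ ℂ).hasFDerivAt.comp_hasDerivAt x (hY x hx))
  have h2 : ∀ x ∈ Set.Ioo (-a) a, HasDerivAt (fun t ↦ (Y t).2) (q x * (Y x).1) x := fun x hx ↦ by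
    simpa [A, Function.comp_def] using
      ((ContinuousLinearMap.snd ℝ ℂ ℂ).hasFDerivAt.comp_hasDerivAt x (hY x hx))
  -- Bootstrapping: the system expresses the derivatives by `y`, `z` and `q`, so each pass gains one
  -- order.
  have hsm : ∀ n : ℕ, ContDiffOn ℝ n (fun t ↦ (Y t).1) (Set.Ioo (-a) a) ∧
      ContDiffOn ℝ n (fun t ↦ (Y t).2) (Set.Ioo (-a) a) := by
    intro n
    induction n with
    | zero =>
      simp only [Nat.cast_zero, contDiffOn_zero]
      exact ⟨fun x hx ↦ (h1 x hx).continuousAt.continuousWithinAt,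
        fun x hx ↦ (h2 x hx).continuousAt.continuousWithinAt⟩
    | succ n ih =>
      push_cast
      rw [contDiffOn_succ_iff_deriv_of_isOpen isOpen_Ioo,
        contDiffOn_succ_iff_deriv_of_isOpen isOpen_Ioo]
      refine ⟨⟨fun x hx ↦ (h1 x hx).differentiableAt.differentiableWithinAt, by simp,
        ih.2.congr fun x hx ↦ (h1 x hx).deriv⟩,
        ⟨fun x hx ↦ (h2 x hx).differentiableAt.differentiableWithinAt, by simp,
        ((contDiffOn_infty.mp hq n).mul ih.1).congr fun x hx ↦ (h2 x hx).deriv⟩⟩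
  exact ⟨_, _, congrArg Prod.fst hY0, congrArg Prod.snd hY0, contDiffOn_infty.mpr fun n ↦ (hsm n).1,
    contDiffOn_infty.mpr fun n ↦ (hsm n).2, h1, h2⟩

/-! ### Pairings, primitives of test functions, variation of parameters -/

namespace CDistribution

section Pairing

variable {Ω : Opens ℝ}

theorem integrable_mul_testFunction {y : ℝ → ℂ} (hy : ContDiffOn ℝ ∞ y Ω) (φ : 𝓓(Ω, ℂ)) :
    Integrable (fun x ↦ y x * φ x) :=
  (testMul y hy φ).continuous.integrable_of_hasCompactSupport (testMul y hy φ).hasCompactSupport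

/-- The functional `φ ↦ ∫ y φ` on test functions. -/
noncomputable def pairing (y : ℝ → ℂ) (hy : ContDiffOn ℝ ∞ y Ω) : 𝓓(Ω, ℂ) →ₗ[ℂ] ℂ where
  toFun φ := ∫ x in Ω, y x * φ x
  map_add' φ ψ := by
    rw [← integral_add (integrable_mul_testFunction hy φ).integrableOn
      (integrable_mul_testFunction hy ψ).integrableOn]
    simp [mul_add]
  map_smul' c φ := by
    rw [RingHom.id_apply, smul_eq_mul, ← integral_const_mul]
    simp [mul_left_comm]

theorem pairing_eq_integral (y : ℝ → ℂ) (hy : ContDiffOn ℝ ∞ y Ω) (φ : 𝓓(Ω, ℂ)) :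
    pairing y hy φ = ∫ x, testMul y hy φ x := by
  refine setIntegral_eq_integral_of_forall_compl_eq_zero fun x hx ↦ ?_
  rw [image_eq_zero_of_notMem_tsupport fun h ↦ hx (φ.tsupport_subset h), mul_zero]

end Pairing

/-- A test function on an interval whose integral vanishes is the derivative of a test function. -/
theorem exists_hasDerivAt_of_integral_eq_zero {a : ℝ} (ψ : 𝓓(symmInterval a, ℂ))
    (h : ∫ x, ψ x = 0) :
    ∃ P : 𝓓(symmInterval a, ℂ), ∀ x, HasDerivAt P (ψ x) x := by
  have hK : IsCompact (tsupport ψ) := ψ.hasCompactSupport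
  obtain ⟨r, hra, hr⟩ : ∃ r < a, ∀ x ∈ tsupport ψ, |x| ≤ r := by
    rcases (tsupport ψ).eq_empty_or_nonempty with he | hne
    · exact ⟨a - 1, by linarith, by simp [he]⟩
    · obtain ⟨x, hx, hmax⟩ := hK.exists_isMaxOn hne continuous_abs.continuousOn
      exact ⟨|x|, abs_lt.mpr (ψ.tsupport_subset hx), hmax⟩
  have hz : ∀ x, r < |x| → ψ x = 0 := fun x hx ↦
    image_eq_zero_of_notMem_tsupport fun hx' ↦ absurd (hr x hx') (not_le.mpr hx)
  have hi : Integrable ψ := ψ.continuous.integrable_of_hasCompactSupport hK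
  have hd : ∀ x, HasDerivAt (fun x ↦ ∫ t in Set.Iic x, ψ t) (ψ x) x := fun x ↦ by
    have h1 : (fun x ↦ ∫ t in Set.Iic x, ψ t) =
        fun x ↦ (∫ t in Set.Iic (0 : ℝ), ψ t) + ∫ t in (0 : ℝ)..x, ψ t := by
      ext x
      rw [← intervalIntegral.integral_Iic_sub_Iic hi.integrableOn hi.integrableOn]
      ring
    rw [h1]
    exact (ψ.continuous.integral_hasStrictDerivAt 0 x).hasDerivAt.const_add _
  -- To the right of the support the primitive equals the total integral, which is 0 by `h`; to the
  -- left the integrand vanishes.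
  have hsupp : ∀ x, r < |x| → ∫ t in Set.Iic x, ψ t = 0 := fun x hx ↦ by
    rcases lt_abs.mp hx with hx | hx
    · rw [setIntegral_eq_integral_of_forall_compl_eq_zero, h]
      exact fun t ht ↦ hz t (lt_abs.mpr (.inl (hx.trans (not_le.mp ht))))
    · refine setIntegral_eq_zero_of_forall_eq_zero fun t ht ↦ hz t (lt_abs.mpr (.inr ?_))
      linarith [Set.mem_Iic.mp ht]
  have hsub : tsupport (fun x ↦ ∫ t in Set.Iic x, ψ t) ⊆ Set.Icc (-r) r := by
    refine closure_minimal (fun x hx ↦ ?_) isClosed_Icc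
    by_contra hx'
    exact hx (hsupp x (not_le.mp fun hle ↦ hx' (abs_le.mp hle)))
  refine ⟨⟨fun x ↦ ∫ t in Set.Iic x, ψ t, ?_, .of_isClosed_subset isCompact_Icc
    (isClosed_tsupport _) hsub, hsub.trans (Set.Icc_subset_Ioo (by linarith) hra)⟩, hd⟩
  refine contDiff_infty_iff_deriv.mpr ⟨fun x ↦ (hd x).differentiableAt, ?_⟩
  rw [funext fun x ↦ (hd x).deriv]
  exact ψ.contDiff

section Operators

variable {Ω : Opens ℝ}

theorem testFunction_apply_eq_zero (φ : 𝓓(Ω, ℂ)) {x : ℝ} (hx : x ∉ Ω) : φ x = 0 :=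
  image_eq_zero_of_notMem_tsupport fun h ↦ hx (φ.tsupport_subset h)

theorem testMul_apply (q : ℝ → ℂ) (hq : ContDiffOn ℝ ∞ q Ω) (φ : 𝓓(Ω, ℂ)) (x : ℝ) :
    testMul q hq φ x = q x * φ x := rfl

/-- The product rule for the product of a smooth function and a test function. -/
theorem testDeriv_testMul {y z : ℝ → ℂ} (hy : ContDiffOn ℝ ∞ y Ω) (hz : ContDiffOn ℝ ∞ z Ω)
    (hd : ∀ x ∈ Ω, HasDerivAt y (z x) x) (P : 𝓓(Ω, ℂ)) :
    testDeriv (testMul y hy P) = testMul z hz P + testMul y hy (testDeriv P) := by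
  ext x
  by_cases hx : x ∈ Ω
  · rw [_root_.add_apply, testMul_apply, testMul_apply, testDeriv_apply, testDeriv_apply]
    exact ((hd x hx).mul ((P.contDiff.differentiable (by simp)) x).hasDerivAt).deriv
  · rw [testFunction_apply_eq_zero _ hx, testFunction_apply_eq_zero _ hx]

end Operators

/-- Variation of parameters: a test function annihilated by a pair of solutions of `y'' = q y` with
Wronskian `1` is of the form `φ'' - q φ` with a test function `φ`. -/
theorem exists_testDeriv_testDeriv_sub_testMul {a : ℝ} {q y₁ z₁ y₂ z₂ : ℝ → ℂ}
    (hq : ContDiffOn ℝ ∞ q (symmInterval a)) (hy₁ : ContDiffOn ℝ ∞ y₁ (symmInterval a))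
    (hz₁ : ContDiffOn ℝ ∞ z₁ (symmInterval a)) (hy₂ : ContDiffOn ℝ ∞ y₂ (symmInterval a))
    (hz₂ : ContDiffOn ℝ ∞ z₂ (symmInterval a))
    (hd₁ : ∀ x ∈ symmInterval a, HasDerivAt y₁ (z₁ x) x)
    (hd₁' : ∀ x ∈ symmInterval a, HasDerivAt z₁ (q x * y₁ x) x)
    (hd₂ : ∀ x ∈ symmInterval a, HasDerivAt y₂ (z₂ x) x)
    (hd₂' : ∀ x ∈ symmInterval a, HasDerivAt z₂ (q x * y₂ x) x)
    (hW : ∀ x ∈ symmInterval a, y₁ x * z₂ x - y₂ x * z₁ x = 1) (ψ : 𝓓(symmInterval a, ℂ))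
    (h₁ : pairing y₁ hy₁ ψ = 0) (h₂ : pairing y₂ hy₂ ψ = 0) :
    ∃ φ, testDeriv (testDeriv φ) - testMul q hq φ = ψ := by
  rw [pairing_eq_integral] at h₁ h₂
  obtain ⟨P₁, hP₁⟩ := exists_hasDerivAt_of_integral_eq_zero _ h₁
  obtain ⟨P₂, hP₂⟩ := exists_hasDerivAt_of_integral_eq_zero _ h₂
  have hP₁' : testDeriv P₁ = testMul y₁ hy₁ ψ := by
    ext x
    rw [testDeriv_apply, (hP₁ x).deriv]
  have hP₂' : testDeriv P₂ = testMul y₂ hy₂ ψ := by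
    ext x
    rw [testDeriv_apply, (hP₂ x).deriv]
  -- The terms `y₂ y₁ ψ` and `y₁ y₂ ψ` cancel here; at the next derivative their analogues combine
  -- to the Wronskian times `ψ`.
  have hφ : testDeriv (testMul y₂ hy₂ P₁ - testMul y₁ hy₁ P₂) =
      testMul z₂ hz₂ P₁ - testMul z₁ hz₁ P₂ := by
    rw [map_sub, testDeriv_testMul hy₂ hz₂ hd₂, testDeriv_testMul hy₁ hz₁ hd₁, hP₁', hP₂']
    ext x
    simp only [_root_.sub_apply, _root_.add_apply, testMul_apply]
    ring
  refine ⟨testMul y₂ hy₂ P₁ - testMul y₁ hy₁ P₂, ?_⟩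
  rw [hφ, map_sub, testDeriv_testMul hz₂ (hq.mul hy₂) hd₂', testDeriv_testMul hz₁ (hq.mul hy₁) hd₁',
    hP₁', hP₂']
  ext x
  by_cases hx : x ∈ symmInterval a
  · simp only [_root_.sub_apply, _root_.add_apply, testMul_apply]
    linear_combination ψ x * hW x hx
  · rw [testFunction_apply_eq_zero _ hx, testFunction_apply_eq_zero _ hx]

/-- The Wronskian of two solutions of `y'' = q y` on an interval is constant. -/
theorem wronskian_eq {a : ℝ} (ha : 0 < a) {q y₁ z₁ y₂ z₂ : ℝ → ℂ}
    (hd₁ : ∀ x ∈ symmInterval a, HasDerivAt y₁ (z₁ x) x)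
    (hd₁' : ∀ x ∈ symmInterval a, HasDerivAt z₁ (q x * y₁ x) x)
    (hd₂ : ∀ x ∈ symmInterval a, HasDerivAt y₂ (z₂ x) x)
    (hd₂' : ∀ x ∈ symmInterval a, HasDerivAt z₂ (q x * y₂ x) x) {x : ℝ}
    (hx : x ∈ symmInterval a) :
    y₁ x * z₂ x - y₂ x * z₁ x = y₁ 0 * z₂ 0 - y₂ 0 * z₁ 0 := by
  have hd : ∀ t ∈ Set.Ioo (-a) a, HasDerivAt (fun t ↦ y₁ t * z₂ t - y₂ t * z₁ t) 0 t := by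
    intro t ht
    exact (((hd₁ t ht).mul (hd₂' t ht)).sub ((hd₂ t ht).mul (hd₁' t ht))).congr_deriv (by ring)
  exact isOpen_Ioo.is_const_of_deriv_eq_zero isPreconnected_Ioo
    (fun t ht ↦ (hd t ht).differentiableAt.differentiableWithinAt) (fun t ht ↦ (hd t ht).deriv) hx
    (show (0 : ℝ) ∈ Set.Ioo (-a) a from ⟨by linarith, ha⟩)

end CDistribution

/-! ### The distribution as a combination of two classical solutions -/

open CDistribution in
theorem mainTheorem10 (a : ℝ) (ha : 0 < a) (q : ℝ → ℂ)
    (hq : ContDiffOn ℝ ∞ q (symmInterval a)) (u : CDistribution (symmInterval a))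
    (hu : u.derivative.derivative = CDistribution.smoothMul q hq u) :
    ∃ f : ℝ → ℂ, ContDiffOn ℝ ∞ f (symmInterval a) ∧
      (∀ x ∈ symmInterval a, deriv (deriv f) x = q x * f x) ∧
      CDistribution.IsRegularOf u f := by
  obtain ⟨y₁, z₁, hy₁0, hz₁0, hy₁, hz₁, hd₁, hd₁'⟩ := exists_smooth_solution hq 1 0
  obtain ⟨y₂, z₂, hy₂0, hz₂0, hy₂, hz₂, hd₂, hd₂'⟩ := exists_smooth_solution hq 0 1
  have hW : ∀ x ∈ symmInterval a, y₁ x * z₂ x - y₂ x * z₁ x = 1 := fun x hx ↦ by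
    rw [wronskian_eq ha hd₁ hd₁' hd₂ hd₂' hx, hy₁0, hz₁0, hz₂0]
    ring
  have hker : ⨅ i, LinearMap.ker (![pairing y₁ hy₁, pairing y₂ hy₂] i) ≤
      LinearMap.ker u.toLinearMap := by
    intro ψ hψ
    simp only [Submodule.mem_iInf, LinearMap.mem_ker, Fin.forall_fin_two] at hψ
    obtain ⟨φ, rfl⟩ := exists_testDeriv_testDeriv_sub_testMul hq hy₁ hz₁ hy₂ hz₂ hd₁ hd₁' hd₂ hd₂'
      hW ψ hψ.1 hψ.2
    have := DFunLike.congr_fun hu φ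
    rw [derivative_apply, derivative_apply, neg_neg, smoothMul_apply] at this
    rw [LinearMap.mem_ker, ContinuousLinearMap.coe_coe, map_sub, this, sub_self]
  -- Linear algebra: a functional vanishing on the common kernel of finitely many functionals lies
  -- in their span.
  have hspan := mem_span_of_iInf_ker_le_ker hker
  rw [Matrix.range_cons_cons_empty, Submodule.mem_span_pair] at hspan
  obtain ⟨c, d, hcd⟩ := hspan
  have hf : ContDiffOn ℝ ∞ (fun x ↦ c * y₁ x + d * y₂ x) (symmInterval a) :=
    (contDiffOn_const.mul hy₁).add (contDiffOn_const.mul hy₂)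
  refine ⟨fun x ↦ c * y₁ x + d * y₂ x, hf, fun x hx ↦ ?_,
    hf.continuousOn.locallyIntegrableOn (symmInterval a).isOpen.measurableSet, fun φ ↦ ?_⟩
  · have h : deriv (fun x ↦ c * y₁ x + d * y₂ x) =ᶠ[nhds x] fun x ↦ c * z₁ x + d * z₂ x := by
      filter_upwards [(symmInterval a).isOpen.mem_nhds hx] with t ht
      exact (((hd₁ t ht).const_mul c).add ((hd₂ t ht).const_mul d)).deriv
    rw [h.deriv_eq]
    refine (((hd₁' x hx).const_mul c).add ((hd₂' x hx).const_mul d)).deriv.trans ?_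
    ring
  · have h := DFunLike.congr_fun hcd φ
    simp only [LinearMap.add_apply, LinearMap.smul_apply, smul_eq_mul] at h
    refine h.symm.trans ?_
    change c * (∫ x in _, _) + d * (∫ x in _, _) = _
    rw [← integral_const_mul, ← integral_const_mul, ← integral_add
      ((integrable_mul_testFunction hy₁ φ).integrableOn.const_mul c)
      ((integrable_mul_testFunction hy₂ φ).integrableOn.const_mul d)]
    simp only [add_mul, mul_assoc]
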